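/- For $N\ge 1$ and an $N\times N$ complex Hadamard matrix $H$ (that is, $H\in M_N(\mathbb T)\cap\sqrt N\,U_N$, where $M_N(\mathbb T)$ is the set of $N\times N$ matrices with all entries of modulus $1$ and $U_N$ is the unitary group), the undephased defect of $H$ is the real dimension $$d(H)=\dim_{\mathbb R}\left(T_HM_N(\mathbb T)\cap T_H\sqrt N\,U_N\right)$$ of the intersection of the tangent spaces at $H$ of the two smooth real submanifolds $M_N(\mathbb T)$ and $\sqrt N\,U_N$ of $M_N(\mathbb C)$. The Fourier matrix of a finite abelian group $G=\mathbb Z_{N_1}\times\cdots\times\mathbb Z_{N_s}$ is $F_G=F_{N_1}\otimes\cdots\otimes F_{N_s}$, where $F_n=(e^{2\pi \mathrm{i}\,jk/n})_{0\le j,k<n}$. **Theorem.** Let $G$ be a finite abelian group, and let $F_G$ be its Fourier matrix with respect to any decomposition of $G$ as a product of cyclic groups. Decompose $G=\prod_{p}G_p$ over a finite set of primes $p$, with $$G_p\cong\mathbb Z_{p^{a_1}}\times\cdots\times\mathbb Z_{p^{a_r}},\qquad a_1\le a_2\le\cdots\le a_r,\qquad a_0=0,$$ where $r$ and the $a_k$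 depend on $p$. Then $$d(F_G)=|G|\prod_p\left(1+\sum_{k=1}^r p^{(r-k)a_{k-1}+(a_1+\cdots+a_{k-1})-1}\,\bigl(p^{r-k+1}-1\bigr)\,[a_k-a_{k-1}]_{p^{r-k}}\right),$$ where $[a]_q=1+q+q^2+\cdots+q^{a-1}$ (so $[0]_q=0$). -/

import Mathlib

open scoped ContDiff

noncomputable section

namespace FourierDefect

variable {ι : Type*} [Fintype ι] [DecidableEq ι]

/-- Matrices all of whose entries lie on the unit circle. -/
def torusMatrices (ι : Type*) : Set (Matrix ι ι ℂ) :=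
  {H | ∀ i j, ‖H i j‖ = 1}

/-- The rescaled unitary group `√N U_N`, where `N` is the number of indices. -/
def scaledUnitary (ι : Type*) [Fintype ι] [DecidableEq ι] : Set (Matrix ι ι ℂ) :=
  {H | ∃ U ∈ Matrix.unitaryGroup ι ℂ, H = ((Real.sqrt (Fintype.card ι) : ℝ) : ℂ) • U}

/-- The tangent space at `H` to a smooth real submanifold `M` of the complex matrices: the real
vector space of the velocities at time `0` of the smooth curves in `M` that pass through `H` at
time `0`. For a submanifold these velocities already form a real vector space, so the span adds
nothing. -/
def tangentSpaceAt (M : Set (Matrix ι ι ℂ)) (H : Matrix ι ι ℂ) : Submodule ℝ (Matrix ι ι ℂ) :=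
  Submodule.span ℝ
    {V | ∃ γ : ℝ → Matrix ι ι ℂ, (∀ i j, ContDiff ℝ ∞ (fun t => γ t i j)) ∧
      (∀ t, γ t ∈ M) ∧ γ 0 = H ∧ ∀ i j, HasDerivAt (fun t => γ t i j) (V i j) 0}

/-- The enveloping tangent space at `H` of the set of complex Hadamard matrices. -/
def envelopingTangentSpace (H : Matrix ι ι ℂ) : Submodule ℝ (Matrix ι ι ℂ) :=
  tangentSpaceAt (torusMatrices ι) H ⊓ tangentSpaceAt (scaledUnitary ι) H

/-- The undephased defect: the real dimension of the enveloping tangent space. -/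
def undephasedDefect (H : Matrix ι ι ℂ) : ℕ :=
  Module.finrank ℝ (envelopingTangentSpace H)

/-- The Fourier matrix `F_N = (w ^ (i j))`, with `w = exp (2 π i / N)` and `0 ≤ i, j < N`. -/
def cyclicFourierMatrix (N : ℕ) : Matrix (ZMod N) (ZMod N) ℂ :=
  Matrix.of fun i j => Complex.exp (2 * Real.pi * Complex.I / N) ^ (i.val * j.val)

/-- The Fourier matrix `F_{N_1} ⊗ ⋯ ⊗ F_{N_s}` of a group `G` identified by `e` with
`ℤ_{N_1} × ⋯ × ℤ_{N_s}`; its rows and columns are indexed by `G`. -/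
def fourierMatrix {G : Type*} [AddCommGroup G] {s : ℕ} {N : Fin s → ℕ}
    (e : G ≃+ ((i : Fin s) → ZMod (N i))) : Matrix G G ℂ :=
  Matrix.of fun g h => ∏ i, cyclicFourierMatrix (N i) (e g i) (e h i)

/-- `[n]_q = 1 + q + ⋯ + q ^ (n - 1)`. -/
def qNumber (n : ℕ) (q : ℚ) : ℚ := ∑ i ∈ Finset.range n, q ^ i

/-- The factor contributed by a prime `p` to the defect, for the exponents
`0 = a 0 ≤ a 1 ≤ ⋯ ≤ a r`. -/
def primeFactorTerm (p r : ℕ) (a : ℕ → ℕ) : ℚ :=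
  1 + ∑ k ∈ Finset.Icc 1 r,
    (p : ℚ) ^ ((((r - k) * a (k - 1) + ∑ l ∈ Finset.Icc 1 (k - 1), a l : ℕ) : ℤ) - 1) *
      ((p : ℚ) ^ (r - k + 1) - 1) * qNumber (a k - a (k - 1)) ((p : ℚ) ^ (r - k))

end FourierDefect

end

/-!
The tangent spaces of the torus and of `√N U_N` at `H` consist of the matrices `(i A_{jk} H_{jk})`
with `A` real and of the matrices `V` with `V Hᴴ` skew-hermitian. In the coordinates `A` their
intersection is cut out by `∑ k, H i k * conj (H j k) * (A i k - A j k) = 0`, a system stable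
under complex conjugation, so the real solutions may be counted over `ℂ`. When the rows of `H`
are the characters of `G`, `H i k * conj (H j k) = H (i - j) k`, and the Fourier transform of the
rows of `A` turns the system into: the `m`-th coefficient is an `m`-periodic function of the row.
Hence `d(F_G) = ∑ m, |G| / ord m`.

The sum of the inverse orders is multiplicative over the primary components. On
`G_p = ∏ k, ℤ_{p ^ a_k}` the number of elements of order `p ^ (j + 1)` is the difference of the
numbers of elements killed by `p ^ (j + 1)` and by `p ^ j`, and `p ^ j` kills
`p ^ (∑ k, min (a_k) j)` elements. For `a_{k-1} ≤ j ≤ a_k` this exponent is an affine function of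
`j`, so that each interval `[a_{k-1}, a_k)` contributes a geometric sum.
-/

noncomputable section

namespace FourierDefect

open Complex ComplexConjugate Matrix

section TorusTangent

theorem inner_deriv_eq_zero_of_norm_eq_const {E : Type*} [NormedAddCommGroup E]
    [InnerProductSpace ℝ E] {c : ℝ → E} {v : E} {t ρ : ℝ} (hc : ∀ t, ‖c t‖ = ρ)
    (hv : HasDerivAt c v t) : inner ℝ (c t) v = 0 := by
  have hderiv := hv.norm_sq
  simp only [hc] at hderiv
  simpa using hderiv.unique (hasDerivAt_const t _)

theorem eq_I_mul_mul_of_inner_eq_zero {z v : ℂ} (hz : ‖z‖ = 1) (h : inner ℝ z v = 0) :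
    v = I * (v * conj z).im * z := by
  have hre : (v * conj z).re = 0 := by rwa [Complex.inner] at h
  have hzz : conj z * z = 1 := by rw [conj_mul', hz, ofReal_one, one_pow]
  calc v = v * conj z * z := by rw [mul_assoc, hzz, mul_one]
    _ = I * (v * conj z).im * z := by
      conv_lhs => rw [← re_add_im (v * conj z), hre, ofReal_zero, zero_add, mul_comm _ I]

/-- The map `A ↦ (i A_{jk} H_{jk})`: on real `A` it parametrises the tangent space at `H` of the
matrices with unimodular entries. It takes complex arguments so that its source carries
both a complex structure and a conjugation, the pointwise star of `ι → ι → ℂ`. -/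
def torusTangent {ι : Type*} (H : Matrix ι ι ℂ) : (ι → ι → ℂ) →ₗ[ℂ] Matrix ι ι ℂ where
  toFun A := of fun i j => I * A i j * H i j
  map_add' A B := by ext i j; simp [mul_add, add_mul]
  map_smul' c A := by ext i j; simp; ring

variable {ι : Type*} {H : Matrix ι ι ℂ}

theorem torusTangent_apply (H : Matrix ι ι ℂ) (A : ι → ι → ℂ) (i j : ι) :
    torusTangent H A i j = I * A i j * H i j :=
  rfl

theorem torusTangent_injective (hH : H ∈ torusMatrices ι) :
    Function.Injective (torusTangent H) := by
  intro A B h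
  ext i j
  have hij := congrFun (congrFun h i) j
  have hne : H i j ≠ 0 := norm_ne_zero_iff.1 (hH i j ▸ one_ne_zero)
  simpa [torusTangent_apply, hne] using hij

theorem tangentSpaceAt_torusMatrices (hH : H ∈ torusMatrices ι) :
    tangentSpaceAt (torusMatrices ι) H =
      (selfAdjoint.submodule ℝ (ι → ι → ℂ)).map ((torusTangent H).restrictScalars ℝ) := by
  apply le_antisymm
  · refine Submodule.span_le.2 ?_
    rintro V ⟨γ, -, hγ, rfl, hV⟩
    refine ⟨fun i j => ((V i j * conj (γ 0 i j)).im : ℂ), ?_, ?_⟩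
    · exact funext₂ fun i j => conj_ofReal _
    · ext i j
      exact (eq_I_mul_mul_of_inner_eq_zero (hH i j)
        (inner_deriv_eq_zero_of_norm_eq_const (fun t => hγ t i j) (hV i j))).symm
  · rintro _ ⟨A, hA, rfl⟩
    refine Submodule.subset_span
      ⟨fun t => of fun i j => exp (t * (I * A i j)) * H i j, fun i j => ?_, fun t i j => ?_, ?_,
        fun i j => ?_⟩
    · exact ((ofRealCLM.contDiff.mul contDiff_const).cexp).mul contDiff_const
    · have hreal : ((A i j).re : ℂ) = A i j := conj_eq_iff_re.1 (congrFun₂ hA i j)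
      change ‖exp (t * (I * A i j)) * H i j‖ = 1
      rw [norm_mul, hH i j, mul_one, ← hreal, mul_left_comm, mul_comm I, ← ofReal_mul,
        norm_exp_ofReal_mul_I]
    · ext i j
      simp
    · refine ((((hasDerivAt_id (0 : ℝ)).ofReal_comp.mul_const (I * A i j)).cexp).mul_const
        (H i j)).congr_deriv ?_
      simp [torusTangent_apply]

end TorusTangent

section UnitaryTangent

variable {ι : Type*} [Fintype ι]

theorem hasDerivAt_mul_conjTranspose {γ : ℝ → Matrix ι ι ℂ} {V : Matrix ι ι ℂ} {t : ℝ}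
    (h : ∀ i j, HasDerivAt (fun t => γ t i j) (V i j) t) (i j : ι) :
    HasDerivAt (fun t => (γ t * (γ t)ᴴ) i j) ((V * (γ t)ᴴ + γ t * Vᴴ) i j) t := by
  simp only [Matrix.add_apply, mul_apply, conjTranspose_apply, ← Finset.sum_add_distrib]
  exact HasDerivAt.fun_sum fun k _ => (h i k).mul (h j k).star

variable [DecidableEq ι] {H : Matrix ι ι ℂ}

theorem mem_scaledUnitary_iff :
    H ∈ scaledUnitary ι ↔ H * Hᴴ = (Fintype.card ι : ℂ) • 1 := by
  set s : ℂ := ((Real.sqrt (Fintype.card ι) : ℝ) : ℂ) with hs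
  have hstar : star s = s := conj_ofReal _
  have hsq : s * s = Fintype.card ι := by
    rw [hs, ← ofReal_mul, Real.mul_self_sqrt (Nat.cast_nonneg _), ofReal_natCast]
  constructor
  · rintro ⟨U, hU, rfl⟩
    rw [conjTranspose_smul, smul_mul_smul_comm, hstar, hsq, ← star_eq_conjTranspose,
      mem_unitaryGroup_iff.1 hU]
  · intro hH
    rcases isEmpty_or_nonempty ι with hι | hι
    · exact ⟨1, one_mem _, Subsingleton.elim _ _⟩
    have hs0 : s ≠ 0 := left_ne_zero_of_mul (hsq ▸ Nat.cast_ne_zero.2 Fintype.card_ne_zero)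
    refine ⟨s⁻¹ • H, mem_unitaryGroup_iff.2 ?_, (smul_inv_smul₀ hs0 H).symm⟩
    rw [star_eq_conjTranspose, conjTranspose_smul, smul_mul_smul_comm, hH, star_inv₀, hstar,
      ← mul_inv, hsq, inv_smul_smul₀ (hsq ▸ mul_self_ne_zero.2 hs0)]

theorem inv_card_smul_conjTranspose_mul [Nonempty ι] (hH : H ∈ scaledUnitary ι) :
    (Fintype.card ι : ℝ)⁻¹ • Hᴴ * H = 1 := by
  rw [mul_eq_one_comm, mul_smul_comm, mem_scaledUnitary_iff.1 hH, Nat.cast_smul_eq_nsmul,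
    ← Nat.cast_smul_eq_nsmul ℝ, inv_smul_smul₀ (Nat.cast_ne_zero.2 Fintype.card_ne_zero)]

theorem tangentSpaceAt_scaledUnitary_le :
    tangentSpaceAt (scaledUnitary ι) H ≤
      (skewAdjoint.submodule ℝ (Matrix ι ι ℂ)).comap (LinearMap.mulRight ℝ Hᴴ) := by
  refine Submodule.span_le.2 ?_
  rintro V ⟨γ, -, hγ, rfl, hV⟩
  have hzero : V * (γ 0)ᴴ + γ 0 * Vᴴ = 0 := by
    ext i j
    have hderiv := hasDerivAt_mul_conjTranspose hV i j
    simp only [mem_scaledUnitary_iff.1 (hγ _)] at hderiv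
    exact hderiv.unique (hasDerivAt_const _ _)
  change (V * (γ 0)ᴴ)ᴴ = -(V * (γ 0)ᴴ)
  rw [conjTranspose_mul, conjTranspose_conjTranspose, eq_neg_of_add_eq_zero_right hzero]

section Exponential

open NormedSpace

attribute [local instance] Matrix.linftyOpNormedAddCommGroup Matrix.linftyOpNormedSpace
  Matrix.linftyOpNormedRing Matrix.linftyOpNormedAlgebra

theorem exp_smul_mem_unitaryGroup {B : Matrix ι ι ℂ} (hB : B ∈ skewAdjoint (Matrix ι ι ℂ))
    (t : ℝ) : exp (t • B) ∈ unitaryGroup ι ℂ := by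
  have hskew : (t • B)ᴴ = -(t • B) := skewAdjoint.mem_iff.1 (skewAdjoint.smul_mem t hB)
  rw [mem_unitaryGroup_iff, star_eq_conjTranspose, ← Matrix.exp_conjTranspose, hskew,
    Matrix.exp_neg]
  exact mul_nonsing_inv _ ((isUnit_iff_isUnit_det _).1 (Matrix.isUnit_exp _))

theorem mul_mem_tangentSpaceAt_scaledUnitary {B : Matrix ι ι ℂ}
    (hB : B ∈ skewAdjoint (Matrix ι ι ℂ)) (hH : H ∈ scaledUnitary ι) :
    B * H ∈ tangentSpaceAt (scaledUnitary ι) H := by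
  let entryMul (i j : ι) : Matrix ι ι ℂ →L[ℝ] ℂ :=
    (entryLinearMap ℝ ℂ i j ∘ₗ LinearMap.mulRight ℝ H).toContinuousLinearMap
  refine Submodule.subset_span ⟨fun t => exp (t • B) * H, fun i j => ?_, fun t => ?_, by simp,
    fun i j => ?_⟩
  · have hexp : ContDiff ℝ ∞ (exp : Matrix ι ι ℂ → Matrix ι ι ℂ) :=
      contDiff_iff_contDiffAt.2 fun X => (exp_analytic (𝕂 := ℝ) X).contDiffAt
    exact (entryMul i j).contDiff.comp (hexp.comp (contDiff_id.smul contDiff_const))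
  · obtain ⟨U, hU, rfl⟩ := hH
    exact ⟨_, mul_mem (exp_smul_mem_unitaryGroup hB t) hU, mul_smul_comm _ _ _⟩
  · have hexp := hasDerivAt_exp_smul_const (𝕂 := ℝ) B (0 : ℝ)
    rw [zero_smul, NormedSpace.exp_zero, one_mul] at hexp
    exact (entryMul i j).hasFDerivAt.comp_hasDerivAt (0 : ℝ) hexp

end Exponential

theorem tangentSpaceAt_scaledUnitary [Nonempty ι] (hH : H ∈ scaledUnitary ι) :
    tangentSpaceAt (scaledUnitary ι) H =
      (skewAdjoint.submodule ℝ (Matrix ι ι ℂ)).comap (LinearMap.mulRight ℝ Hᴴ) := by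
  refine le_antisymm tangentSpaceAt_scaledUnitary_le fun V hV => ?_
  have hskew : (Fintype.card ι : ℝ)⁻¹ • (V * Hᴴ) ∈ skewAdjoint (Matrix ι ι ℂ) :=
    skewAdjoint.smul_mem _ hV
  have hmul : (Fintype.card ι : ℝ)⁻¹ • (V * Hᴴ) * H = V := by
    rw [← mul_smul_comm, mul_assoc, inv_card_smul_conjTranspose_mul hH, mul_one]
  exact hmul ▸ mul_mem_tangentSpaceAt_scaledUnitary hskew hH

end UnitaryTangent

section Complexification

variable {E : Type*} [AddCommGroup E] [Module ℂ E] [StarAddMonoid E] [StarModule ℂ E]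

open ComplexStarModule

/-- The self-adjoint elements of a complex subspace, as a real subspace: its real form, when the
subspace is stable under the conjugation `star`. -/
def selfAdjointPoints (W : Submodule ℂ E) : Submodule ℝ E :=
  selfAdjoint.submodule ℝ E ⊓ W.restrictScalars ℝ

theorem realPart_mem_selfAdjointPoints {W : Submodule ℂ E} (hW : ∀ x ∈ W, star x ∈ W) {x : E}
    (hx : x ∈ W) : (ℜ x : E) ∈ selfAdjointPoints W := by
  refine ⟨(ℜ x).2, ?_⟩
  rw [realPart_apply_coe]
  exact (W.restrictScalars ℝ).smul_mem _ (W.add_mem hx (hW x hx))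

theorem imaginaryPart_mem_selfAdjointPoints {W : Submodule ℂ E} (hW : ∀ x ∈ W, star x ∈ W) {x : E}
    (hx : x ∈ W) : (ℑ x : E) ∈ selfAdjointPoints W := by
  have h := realPart_mem_selfAdjointPoints hW (W.smul_mem (-I) hx)
  rwa [neg_smul, map_neg, realPart_I_smul, neg_neg] at h

/-- The decomposition of a conjugation-stable complex subspace into real and imaginary parts. -/
def realImaginaryEquiv {W : Submodule ℂ E} (hW : ∀ x ∈ W, star x ∈ W) :
    W ≃ₗ[ℝ] selfAdjointPoints W × selfAdjointPoints W where
  toFun x := (⟨ℜ (x : E), realPart_mem_selfAdjointPoints hW x.2⟩,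
    ⟨ℑ (x : E), imaginaryPart_mem_selfAdjointPoints hW x.2⟩)
  map_add' x y := by ext <;> simp
  map_smul' c x := by ext <;> simp
  invFun y := ⟨y.1 + I • (y.2 : E), W.add_mem y.1.2.2 (W.smul_mem I y.2.2.2)⟩
  left_inv x := Subtype.ext (realPart_add_I_smul_imaginaryPart (x : E))
  right_inv y := by
    obtain ⟨⟨a, ha, _⟩, ⟨b, hb, _⟩⟩ := y
    have ha : IsSelfAdjoint a := ha
    have hb : IsSelfAdjoint b := hb
    ext
    · simp [ha.coe_realPart, hb.imaginaryPart]
    · simp [hb.coe_realPart, ha.imaginaryPart]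

theorem finrank_selfAdjointPoints [FiniteDimensional ℂ E] {W : Submodule ℂ E}
    (hW : ∀ x ∈ W, star x ∈ W) :
    Module.finrank ℝ (selfAdjointPoints W) = Module.finrank ℂ W := by
  have hprod := (realImaginaryEquiv hW).finrank_eq
  rw [finrank_real_of_complex, Module.finrank_prod, ← two_mul] at hprod
  exact (mul_left_cancel₀ two_ne_zero hprod).symm

end Complexification

section Deformations

variable {ι : Type*} [Fintype ι]

/-- The complex first-order deformations of `H`: the complexification of the system
`∑ k, H i k * conj (H j k) * (A i k - A j k) = 0` that cuts out the enveloping tangent space of a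
complex Hadamard matrix `H` in the coordinates `V = torusTangent H A`. -/
def firstOrderDeformations (H : Matrix ι ι ℂ) : Submodule ℂ (ι → ι → ℂ) where
  carrier := {A | ∀ i j, ∑ k, H i k * conj (H j k) * (A i k - A j k) = 0}
  zero_mem' := by simp
  add_mem' {A B} hA hB i j := by
    simp only [Pi.add_apply, add_sub_add_comm, mul_add, Finset.sum_add_distrib, hA i j, hB i j,
      add_zero]
  smul_mem' c A hA i j := by
    simp only [Pi.smul_apply, ← smul_sub, mul_smul_comm, ← Finset.smul_sum, hA i j, smul_zero]

theorem star_mem_firstOrderDeformations {H : Matrix ι ι ℂ} :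
    ∀ A ∈ firstOrderDeformations H, star A ∈ firstOrderDeformations H := by
  intro A hA i j
  calc ∑ k, H i k * conj (H j k) * (star A i k - star A j k)
      = -conj (∑ k, H j k * conj (H i k) * (A j k - A i k)) := by
        rw [map_sum, ← Finset.sum_neg_distrib]
        refine Finset.sum_congr rfl fun k _ => ?_
        simp only [Pi.star_apply, RCLike.star_def, map_mul, map_sub, conj_conj]
        ring
    _ = 0 := by rw [hA j i, map_zero, neg_zero]

theorem torusTangent_mul_conjTranspose_add {H : Matrix ι ι ℂ} {A : ι → ι → ℂ}
    (hA : IsSelfAdjoint A) (i j : ι) :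
    (torusTangent H A * Hᴴ + (torusTangent H A * Hᴴ)ᴴ) i j =
      I * ∑ k, H i k * conj (H j k) * (A i k - A j k) := by
  have hconj (k l : ι) : conj (A k l) = A k l := congrFun₂ hA k l
  simp only [conjTranspose_mul, conjTranspose_conjTranspose, Matrix.add_apply, mul_apply,
    conjTranspose_apply, torusTangent_apply, ← Finset.sum_add_distrib, Finset.mul_sum]
  refine Finset.sum_congr rfl fun k _ => ?_
  simp only [RCLike.star_def, map_mul, conj_I, hconj]
  ring

theorem torusTangent_mul_conjTranspose_mem_skewAdjoint {H : Matrix ι ι ℂ} {A : ι → ι → ℂ}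
    (hA : IsSelfAdjoint A) :
    torusTangent H A * Hᴴ ∈ skewAdjoint (Matrix ι ι ℂ) ↔ A ∈ firstOrderDeformations H := by
  rw [skewAdjoint.mem_iff, eq_neg_iff_add_eq_zero, add_comm, star_eq_conjTranspose,
    ← Matrix.ext_iff]
  simp only [torusTangent_mul_conjTranspose_add hA, Matrix.zero_apply, mul_eq_zero, I_ne_zero,
    false_or]
  rfl

variable [DecidableEq ι]

theorem envelopingTangentSpace_eq_map [Nonempty ι] {H : Matrix ι ι ℂ} (hT : H ∈ torusMatrices ι)
    (hU : H ∈ scaledUnitary ι) :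
    envelopingTangentSpace H =
      (selfAdjointPoints (firstOrderDeformations H)).map
        ((torusTangent H).restrictScalars ℝ) := by
  rw [envelopingTangentSpace, tangentSpaceAt_torusMatrices hT, tangentSpaceAt_scaledUnitary hU,
    Submodule.map_inf_eq_map_inf_comap]
  congr 1
  ext A
  exact and_congr_right torusTangent_mul_conjTranspose_mem_skewAdjoint

theorem undephasedDefect_eq_finrank [Nonempty ι] {H : Matrix ι ι ℂ} (hT : H ∈ torusMatrices ι)
    (hU : H ∈ scaledUnitary ι) :
    undephasedDefect H = Module.finrank ℂ (firstOrderDeformations H) := by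
  have hinj : Function.Injective ((torusTangent H).restrictScalars ℝ) := torusTangent_injective hT
  rw [undephasedDefect, envelopingTangentSpace_eq_map hT hU,
    ← (Submodule.equivMapOfInjective _ hinj _).finrank_eq,
    finrank_selfAdjointPoints star_mem_firstOrderDeformations]

end Deformations

section PeriodicFunctions

variable {R G : Type*} [AddCommGroup G]

/-- The functions on `G` that are invariant under translation by `c`. -/
def periodicFunctions (R : Type*) [Semiring R] (c : G) : Submodule R (G → R) where
  carrier := {f | Function.Periodic f c}
  zero_mem' _ := rfl
  add_mem' hf hg := hf.add hg
  smul_mem' a _ hf := hf.smul a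

/-- A function invariant under translation by `c` is a function on `G ⧸ ⟨c⟩`. -/
def periodicFunctionsEquiv (R : Type*) [Semiring R] (c : G) :
    periodicFunctions R c ≃ₗ[R] (G ⧸ AddSubgroup.zmultiples c → R) where
  toFun f := f.2.lift
  map_add' f g := funext <| QuotientAddGroup.mk_surjective.forall.2 fun _ => rfl
  map_smul' a f := funext <| QuotientAddGroup.mk_surjective.forall.2 fun _ => rfl
  invFun g := ⟨fun x => g x, fun x => congrArg g <| by simp⟩
  left_inv _ := rfl
  right_inv g := funext <| QuotientAddGroup.mk_surjective.forall.2 fun _ => rfl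

theorem finrank_periodicFunctions [Semiring R] [StrongRankCondition R] [Finite G] (c : G) :
    Module.finrank R (periodicFunctions R c) = Nat.card G / addOrderOf c := by
  have := Fintype.ofFinite (G ⧸ AddSubgroup.zmultiples c)
  rw [(periodicFunctionsEquiv R c).finrank_eq, Module.finrank_fintype_fun_eq_card,
    ← Nat.card_eq_fintype_card,
    (AddSubgroup.zmultiples c).card_eq_card_quotient_mul_card_addSubgroup, Nat.card_zmultiples,
    Nat.mul_div_cancel _ (addOrderOf_pos c)]

end PeriodicFunctions

section CharacterMatrix

variable {G : Type*} [AddCommGroup G]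

/-- The character table of `G`, with the characters indexed by `G` itself through `χ`. -/
def characterMatrix (χ : G →+ AddChar G ℂ) : Matrix G G ℂ :=
  of fun g h => χ g h

theorem characterMatrix_apply (χ : G →+ AddChar G ℂ) (g h : G) :
    characterMatrix χ g h = χ g h :=
  rfl

theorem characterMatrix_mem_torusMatrices [Finite G] (χ : G →+ AddChar G ℂ) :
    characterMatrix χ ∈ torusMatrices G :=
  fun g h => (χ g).norm_apply h

theorem characterMatrix_mul_conj [Finite G] (χ : G →+ AddChar G ℂ) (i j k : G) :
    characterMatrix χ i k * conj (characterMatrix χ j k) = characterMatrix χ (i - j) k := by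
  simp only [characterMatrix_apply, map_sub, AddChar.sub_apply, AddChar.map_neg_eq_conj]

variable [Fintype G]

theorem mem_firstOrderDeformations_characterMatrix {χ : G →+ AddChar G ℂ} {A : G → G → ℂ} :
    A ∈ firstOrderDeformations (characterMatrix χ) ↔
      ∀ m, Function.Periodic (fun i => (characterMatrix χ *ᵥ A i) m) m := by
  have hsum (i j : G) :
      ∑ k, characterMatrix χ i k * conj (characterMatrix χ j k) * (A i k - A j k) =
        (characterMatrix χ *ᵥ A i) (i - j) - (characterMatrix χ *ᵥ A j) (i - j) := by
    simp only [mulVec, dotProduct, characterMatrix_mul_conj, mul_sub, Finset.sum_sub_distrib]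
  constructor
  · intro hA m j
    have hmj := hA (j + m) j
    rwa [hsum, add_sub_cancel_left, sub_eq_zero] at hmj
  · intro hA i j
    have hij := hA (i - j) j
    simp only [add_sub_cancel] at hij
    rw [hsum, hij, sub_self]

variable [DecidableEq G] {χ : G →+ AddChar G ℂ}

theorem characterMatrix_mem_scaledUnitary (hχ : Function.Injective χ) :
    characterMatrix χ ∈ scaledUnitary G := by
  classical
  refine mem_scaledUnitary_iff.2 ?_
  ext i j
  simp only [mul_apply, conjTranspose_apply, RCLike.star_def, characterMatrix_mul_conj]
  simp only [characterMatrix_apply, AddChar.sum_eq_ite, map_eq_zero_iff χ hχ, sub_eq_zero,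
    Matrix.smul_apply, one_apply, smul_eq_mul, mul_ite, mul_one, mul_zero]

/-- The Fourier transform `A i ↦ F *ᵥ A i` of each row carries the first-order deformations of
a character matrix `F` to the families of functions of `i` that are `m`-periodic at frequency
`m`. -/
def firstOrderDeformationsEquiv (hχ : Function.Injective χ) :
    firstOrderDeformations (characterMatrix χ) ≃ₗ[ℂ] ((m : G) → periodicFunctions ℂ m) :=
  have hdet : IsUnit (characterMatrix χ).det :=
    isUnit_det_of_left_inverse
      (inv_card_smul_conjTranspose_mul (characterMatrix_mem_scaledUnitary hχ))
  { toFun A m := ⟨fun i => (characterMatrix χ *ᵥ A.1 i) m,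
      mem_firstOrderDeformations_characterMatrix.1 A.2 m⟩
    map_add' A B := by
      ext m i
      simp [mulVec_add]
    map_smul' c A := by
      ext m i
      simp [mulVec_smul]
    invFun P := ⟨fun i => (characterMatrix χ)⁻¹ *ᵥ fun m => (P m).1 i,
      mem_firstOrderDeformations_characterMatrix.2 fun m => by
        simp only [mulVec_mulVec, mul_nonsing_inv _ hdet, one_mulVec]
        exact (P m).2⟩
    left_inv A := by
      ext i : 2
      simp only [mulVec_mulVec, nonsing_inv_mul _ hdet, one_mulVec]
    right_inv P := by
      ext m i
      simp only [mulVec_mulVec, mul_nonsing_inv _ hdet, one_mulVec] }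

theorem undephasedDefect_characterMatrix (hχ : Function.Injective χ) :
    undephasedDefect (characterMatrix χ) = ∑ m : G, Fintype.card G / addOrderOf m := by
  rw [undephasedDefect_eq_finrank (characterMatrix_mem_torusMatrices χ)
    (characterMatrix_mem_scaledUnitary hχ), (firstOrderDeformationsEquiv hχ).finrank_eq,
    Module.finrank_pi_fintype]
  simp only [finrank_periodicFunctions, Nat.card_eq_fintype_card]

end CharacterMatrix

section FourierMatrix

theorem cyclicFourierMatrix_apply {N : ℕ} [NeZero N] (i j : ZMod N) :
    cyclicFourierMatrix N i j = ZMod.stdAddChar (i * j) := by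
  have hval : i * j = ((i.val * j.val : ℤ) : ZMod N) := by simp
  rw [hval, ZMod.stdAddChar_coe, cyclicFourierMatrix, of_apply, ← exp_nat_mul]
  congr 1
  push_cast
  ring

theorem neZero_of_addEquiv_pi_zmod {G κ : Type*} [AddCommGroup G] [Finite G] {N : κ → ℕ}
    (e : G ≃+ ((i : κ) → ZMod (N i))) (i : κ) : NeZero (N i) := by
  refine ⟨fun hN => ?_⟩
  have hfin : Finite (ZMod (N i)) := Finite.of_surjective (fun g => e g i)
    ((Function.surjective_eval i).comp e.surjective)
  rw [hN] at hfin
  exact (inferInstance : Infinite ℤ).not_finite hfin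

variable {G : Type*} [AddCommGroup G] {s : ℕ} {N : Fin s → ℕ}

/-- The self-pairing of `G ≃ ℤ_{N_1} × ⋯ × ℤ_{N_s}` given by the product of the standard
pairings of the cyclic factors, as a homomorphism to the characters of `G`. -/
def fourierPairing [∀ i, NeZero (N i)] (e : G ≃+ ((i : Fin s) → ZMod (N i))) :
    G →+ AddChar G ℂ where
  toFun g :=
    { toFun h := ∏ i, ZMod.stdAddChar (e g i * e h i)
      map_zero_eq_one' := by simp
      map_add_eq_mul' h k := by
        simp [mul_add, AddChar.map_add_eq_mul, Finset.prod_mul_distrib] }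
  map_zero' := by ext; simp
  map_add' g h := by ext; simp [add_mul, AddChar.map_add_eq_mul, Finset.prod_mul_distrib]

theorem fourierPairing_apply [∀ i, NeZero (N i)] (e : G ≃+ ((i : Fin s) → ZMod (N i))) (g h : G) :
    fourierPairing e g h = ∏ i, ZMod.stdAddChar (e g i * e h i) :=
  rfl

theorem fourierPairing_injective [∀ i, NeZero (N i)] (e : G ≃+ ((i : Fin s) → ZMod (N i))) :
    Function.Injective (fourierPairing e) := by
  refine (injective_iff_map_eq_zero _).2 fun g hg => e.injective <| funext fun i => ?_
  have hsingle : ZMod.stdAddChar (e g i) = (1 : ℂ) := by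
    have heval := DFunLike.congr_fun hg (e.symm (Pi.single i 1))
    rwa [fourierPairing_apply, Finset.prod_eq_single i (fun j _ hj => by simp [hj]) (by simp),
      e.apply_symm_apply, Pi.single_eq_same, mul_one, AddChar.zero_apply] at heval
  rw [map_zero, Pi.zero_apply]
  exact ZMod.injective_stdAddChar (hsingle.trans (AddChar.map_zero_eq_one _).symm)

theorem fourierMatrix_eq_characterMatrix [∀ i, NeZero (N i)]
    (e : G ≃+ ((i : Fin s) → ZMod (N i))) :
    fourierMatrix e = characterMatrix (fourierPairing e) := by
  ext g h
  simp only [fourierMatrix, of_apply, cyclicFourierMatrix_apply, characterMatrix_apply,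
    fourierPairing_apply]

theorem undephasedDefect_fourierMatrix [Fintype G] [DecidableEq G]
    (e : G ≃+ ((i : Fin s) → ZMod (N i))) :
    undephasedDefect (fourierMatrix e) = ∑ g : G, Fintype.card G / addOrderOf g := by
  have := neZero_of_addEquiv_pi_zmod e
  rw [fourierMatrix_eq_characterMatrix, undephasedDefect_characterMatrix
    (fourierPairing_injective e)]

end FourierMatrix

section InvOrderSum

/-- The sum of the inverses of the orders of the elements of a finite group: the defect of its
Fourier matrices, divided by the order of the group. -/
def invOrderSum (A : Type*) [AddMonoid A] [Fintype A] : ℚ :=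
  ∑ x : A, (addOrderOf x : ℚ)⁻¹

theorem invOrderSum_congr {A B : Type*} [AddMonoid A] [AddMonoid B] [Fintype A] [Fintype B]
    (e : A ≃+ B) : invOrderSum A = invOrderSum B :=
  Fintype.sum_equiv e.toEquiv _ _ fun x => congrArg (fun n : ℕ => (n : ℚ)⁻¹)
    (e.addOrderOf_eq x).symm

theorem invOrderSum_pi {κ : Type*} [Fintype κ] [DecidableEq κ] {M : κ → Type*}
    [∀ i, AddGroup (M i)] [∀ i, Fintype (M i)]
    (h : Pairwise fun i j => (Fintype.card (M i)).Coprime (Fintype.card (M j))) :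
    invOrderSum ((i : κ) → M i) = ∏ i, invOrderSum (M i) := by
  simp only [invOrderSum, Fintype.prod_sum]
  refine Finset.sum_congr rfl fun x _ => ?_
  rw [Pi.addOrderOf, Finset.lcm_eq_prod, Nat.cast_prod, Finset.prod_inv_distrib]
  exact fun i _ j _ hij => (h hij).of_dvd addOrderOf_dvd_card addOrderOf_dvd_card

theorem coprime_card_pi_zmod_pow {κ κ' : Type*} [Fintype κ] [Fintype κ'] [DecidableEq κ]
    [DecidableEq κ'] {p q : ℕ} (hpq : p.Coprime q) (b : κ → ℕ) (c : κ' → ℕ)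
    [∀ k, NeZero (p ^ b k)] [∀ k, NeZero (q ^ c k)] :
    (Fintype.card ((k : κ) → ZMod (p ^ b k))).Coprime
      (Fintype.card ((k : κ') → ZMod (q ^ c k))) := by
  simp only [Fintype.card_pi, ZMod.card]
  exact Nat.Coprime.prod_left fun k _ => Nat.Coprime.prod_right fun l _ => hpq.pow _ _

theorem cast_sum_card_div_addOrderOf (A : Type*) [AddGroup A] [Fintype A] :
    ((∑ x : A, Fintype.card A / addOrderOf x : ℕ) : ℚ) = Fintype.card A * invOrderSum A := by
  rw [invOrderSum, Nat.cast_sum, Finset.mul_sum]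
  refine Finset.sum_congr rfl fun x _ => ?_
  rw [Nat.cast_div addOrderOf_dvd_card (Nat.cast_ne_zero.2 (addOrderOf_pos x).ne'),
    div_eq_mul_inv]

end InvOrderSum

section Torsion

/-- The number of elements killed by `n`, or `0` if there are infinitely many. The elements of a
given prime power order are counted by its increments. -/
def torsionCard (A : Type*) [AddCommGroup A] (n : ℕ) : ℕ :=
  Nat.card (nsmulAddMonoidHom n : A →+ A).ker

theorem torsionCard_pi {κ : Type*} [Fintype κ] (M : κ → Type*) [∀ i, AddCommGroup (M i)]
    (n : ℕ) : torsionCard ((i : κ) → M i) n = ∏ i, torsionCard (M i) n := by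
  simp only [torsionCard, ← Nat.card_pi]
  exact Nat.card_congr ((Equiv.subtypeEquivRight fun _ => funext_iff).trans
    (Equiv.subtypePiEquivPi (p := fun i x => x ∈ (nsmulAddMonoidHom n : M i →+ M i).ker)))

theorem torsionCard_zmod (m n : ℕ) [NeZero m] : torsionCard (ZMod m) n = m.gcd n := by
  rw [torsionCard, IsAddCyclic.card_nsmulAddMonoidHom_ker, Nat.card_zmod]

theorem torsionCard_pi_zmod_pow {κ : Type*} [Fintype κ] (p : ℕ) [NeZero p] (b : κ → ℕ) (j : ℕ) :
    torsionCard ((k : κ) → ZMod (p ^ b k)) (p ^ j) = p ^ ∑ k, min (b k) j := by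
  have hgcd (b j : ℕ) : (p ^ b).gcd (p ^ j) = p ^ min b j := by
    rcases le_total b j with h | h
    · rw [min_eq_left h, Nat.gcd_eq_left (pow_dvd_pow p h)]
    · rw [min_eq_right h, Nat.gcd_eq_right (pow_dvd_pow p h)]
  simp only [torsionCard_pi, torsionCard_zmod, hgcd, Finset.prod_pow_eq_pow_sum]

variable {A : Type*} [AddCommGroup A] [Fintype A]

theorem sum_card_addOrderOf_eq_torsionCard {n : ℕ} (hn : n ≠ 0) :
    ∑ m ∈ n.divisors, (Finset.univ.filter fun x : A => addOrderOf x = m).card =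
      torsionCard A n := by
  classical
  rw [sum_card_addOrderOf_eq_card_nsmul_eq_zero hn, torsionCard, ← Fintype.card_subtype,
    ← Nat.card_eq_fintype_card]
  rfl

theorem card_addOrderOf_eq_prime_pow_succ {p : ℕ} (hp : p.Prime) (j : ℕ) :
    ((Finset.univ.filter fun x : A => addOrderOf x = p ^ (j + 1)).card : ℚ) =
      torsionCard A (p ^ (j + 1)) - torsionCard A (p ^ j) := by
  rw [← sum_card_addOrderOf_eq_torsionCard (pow_ne_zero _ hp.ne_zero),
    ← sum_card_addOrderOf_eq_torsionCard (pow_ne_zero _ hp.ne_zero),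
    Nat.sum_divisors_prime_pow hp, Nat.sum_divisors_prime_pow hp, Finset.sum_range_succ _ (j + 1),
    Nat.cast_add, add_sub_cancel_left]

theorem invOrderSum_eq_sum_torsionCard {p b : ℕ} (hp : p.Prime) (hb : ∀ x : A, p ^ b • x = 0) :
    invOrderSum A = 1 + ∑ j ∈ Finset.range b,
      ((torsionCard A (p ^ (j + 1)) : ℚ) - torsionCard A (p ^ j)) * ((p : ℚ) ^ (j + 1))⁻¹ := by
  classical
  have hdvd (x : A) (_ : x ∈ Finset.univ) : addOrderOf x ∈ (p ^ b).divisors :=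
    Nat.mem_divisors.2 ⟨addOrderOf_dvd_of_nsmul_eq_zero (hb x), pow_ne_zero _ hp.ne_zero⟩
  have hone : (Finset.univ.filter fun x : A => addOrderOf x = 1).card = 1 :=
    Finset.card_eq_one.2 ⟨0, by ext x; simp⟩
  rw [invOrderSum, ← Finset.sum_fiberwise_of_maps_to' hdvd fun n => (n : ℚ)⁻¹]
  simp only [Finset.sum_const, nsmul_eq_mul]
  rw [Nat.sum_divisors_prime_pow hp, Finset.sum_range_succ', add_comm]
  simp only [card_addOrderOf_eq_prime_pow_succ hp, pow_zero, hone, Nat.cast_one, inv_one, mul_one,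
    Nat.cast_pow]

end Torsion

section PrimeFactor

variable {a : ℕ → ℕ} {r : ℕ}

theorem sum_range_eq_sum_blocks {M : Type*} [AddCommMonoid M] (f : ℕ → M) (ha_zero : a 0 = 0)
    (ha : MonotoneOn a (Set.Iic r)) :
    ∑ j ∈ Finset.range (a r), f j =
      ∑ k ∈ Finset.Icc 1 r, ∑ i ∈ Finset.range (a k - a (k - 1)), f (a (k - 1) + i) := by
  induction r with
  | zero => simp [ha_zero]
  | succ r ih =>
    have hle : a r ≤ a (r + 1) := ha r.le_succ Set.self_mem_Iic r.le_succ
    rw [Finset.sum_Icc_succ_top r.succ_pos, ← ih (ha.mono (Set.Iic_subset_Iic.2 r.le_succ)),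
      Nat.add_sub_cancel, ← Finset.sum_range_add, Nat.add_sub_cancel' hle]

theorem sum_min_eq (ha : MonotoneOn a (Set.Iic r)) {m j : ℕ} (hm : m < r) (hj : a m ≤ j)
    (hj' : j ≤ a (m + 1)) :
    ∑ l ∈ Finset.Icc 1 r, min (a l) j = ∑ l ∈ Finset.Icc 1 m, a l + (r - m) * j := by
  have hIcc (n : ℕ) : Finset.Icc 1 n = Finset.Ioc 0 n := rfl
  rw [hIcc, hIcc, ← Finset.sum_Ioc_consecutive _ m.zero_le hm.le, ← Nat.card_Ioc, ← smul_eq_mul,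
    ← Finset.sum_const]
  congr 1
  · refine Finset.sum_congr rfl fun l hl => min_eq_left (le_trans ?_ hj)
    have hlm := (Finset.mem_Ioc.1 hl).2
    exact ha (hlm.trans hm.le) hm.le hlm
  · refine Finset.sum_congr rfl fun l hl => min_eq_right (hj'.trans ?_)
    have hml := Finset.mem_Ioc.1 hl
    exact ha hm hml.2 hml.1

theorem sum_fin_min_eq (ha : MonotoneOn a (Set.Iic r)) {m j : ℕ} (hm : m < r) (hj : a m ≤ j)
    (hj' : j ≤ a (m + 1)) :
    ∑ k : Fin r, min (a (k + 1)) j = ∑ l ∈ Finset.Icc 1 m, a l + (r - m) * j := by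
  rw [← sum_min_eq ha hm hj hj', Fin.sum_univ_eq_sum_range (fun k => min (a (k + 1)) j) r,
    Finset.range_eq_Ico, Finset.sum_Ico_add' (fun l => min (a l) j) 0 r 1]
  rfl

theorem pow_smul_pi_zmod_eq_zero (p : ℕ) (ha : MonotoneOn a (Set.Iic r))
    (x : (k : Fin r) → ZMod (p ^ a (k + 1))) : p ^ a r • x = 0 := by
  funext k
  have hk : (k : ℕ) + 1 ≤ r := k.2
  rw [Pi.smul_apply, nsmul_eq_mul, (ZMod.natCast_eq_zero_iff _ _).2
    (pow_dvd_pow p (ha hk Set.self_mem_Iic hk)), zero_mul, Pi.zero_apply]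

theorem torsionCard_sub_mul_inv_pow {p : ℕ} [NeZero p] (ha : MonotoneOn a (Set.Iic r))
    {k i : ℕ} (hk : k ∈ Finset.Icc 1 r) (hi : i < a k - a (k - 1)) :
    ((torsionCard ((l : Fin r) → ZMod (p ^ a (l + 1))) (p ^ (a (k - 1) + i + 1)) : ℚ) -
        torsionCard ((l : Fin r) → ZMod (p ^ a (l + 1))) (p ^ (a (k - 1) + i))) *
        ((p : ℚ) ^ (a (k - 1) + i + 1))⁻¹ =
      (p : ℚ) ^ ((((r - k) * a (k - 1) + ∑ l ∈ Finset.Icc 1 (k - 1), a l : ℕ) : ℤ) - 1) *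
        ((p : ℚ) ^ (r - k + 1) - 1) * ((p : ℚ) ^ (r - k)) ^ i := by
  have hp : (p : ℚ) ≠ 0 := NeZero.ne _
  obtain ⟨m, rfl⟩ := Nat.exists_eq_add_of_le' (Finset.mem_Icc.1 hk).1
  obtain ⟨q, rfl⟩ := Nat.exists_eq_add_of_le (Finset.mem_Icc.1 hk).2
  rw [Nat.add_sub_cancel] at hi ⊢
  rw [torsionCard_pi_zmod_pow, torsionCard_pi_zmod_pow,
    sum_fin_min_eq (m := m) ha (by omega) (by omega) (by omega),
    sum_fin_min_eq (m := m) ha (by omega) (by omega) (by omega),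
    Nat.add_sub_cancel_left, show m + 1 + q - m = q + 1 by omega, zpow_sub_one₀ hp, zpow_natCast]
  push_cast
  field_simp
  ring

theorem invOrderSum_pi_zmod_prime_pow {p : ℕ} (hp : p.Prime)
    [∀ k : Fin r, NeZero (p ^ a (k + 1))] (ha_zero : a 0 = 0) (ha : MonotoneOn a (Set.Iic r)) :
    invOrderSum ((k : Fin r) → ZMod (p ^ a (k + 1))) = primeFactorTerm p r a := by
  have : NeZero p := ⟨hp.ne_zero⟩
  rw [invOrderSum_eq_sum_torsionCard hp (pow_smul_pi_zmod_eq_zero p ha),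
    sum_range_eq_sum_blocks _ ha_zero ha, primeFactorTerm]
  congr 1
  refine Finset.sum_congr rfl fun k hk => ?_
  rw [qNumber, Finset.mul_sum]
  exact Finset.sum_congr rfl fun i hi =>
    torsionCard_sub_mul_inv_pow ha hk (Finset.mem_range.1 hi)

end PrimeFactor

end FourierDefect

end

theorem theorem5p6 {G : Type*} [AddCommGroup G] [Fintype G] [DecidableEq G]
    -- a decomposition into cyclic groups, which gives the Fourier matrix
    {s : ℕ} {N : Fin s → ℕ} (e : G ≃+ ((i : Fin s) → ZMod (N i)))
    -- the decomposition into `p`-components, `G_p = ℤ_{p ^ a_1} × ⋯ × ℤ_{p ^ a_r}`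
    (S : Finset ℕ) (hS : ∀ p ∈ S, p.Prime)
    (r : ℕ → ℕ) (a : ℕ → ℕ → ℕ)
    (ha_zero : ∀ p ∈ S, a p 0 = 0)
    (ha_mono : ∀ p ∈ S, ∀ k, 1 ≤ k → k < r p → a p k ≤ a p (k + 1))
    (decomp : G ≃+ ((p : S) → (k : Fin (r p)) → ZMod ((p : ℕ) ^ a p (k + 1)))) :
    (FourierDefect.undephasedDefect (FourierDefect.fourierMatrix e) : ℚ) =
      Fintype.card G * ∏ p ∈ S, FourierDefect.primeFactorTerm p (r p) (a p) := by
  have hne (p : S) (k : Fin (r p)) : NeZero ((p : ℕ) ^ a p (k + 1)) :=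
    ⟨pow_ne_zero _ (hS p p.2).ne_zero⟩
  have hmono (p : S) : MonotoneOn (a p) (Set.Iic (r p)) := by
    refine monotoneOn_of_le_add_one Set.ordConnected_Iic fun k _ _ hk => ?_
    rcases Nat.eq_zero_or_pos k with rfl | hk0
    · exact (ha_zero p p.2).trans_le (Nat.zero_le _)
    · exact ha_mono p p.2 k hk0 hk
  have hcoprime (p q : S) (hpq : p ≠ q) : (p : ℕ).Coprime q :=
    (Nat.coprime_primes (hS p p.2) (hS q q.2)).2 (Subtype.coe_ne_coe.2 hpq)
  rw [FourierDefect.undephasedDefect_fourierMatrix, FourierDefect.cast_sum_card_div_addOrderOf,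
    FourierDefect.invOrderSum_congr decomp,
    FourierDefect.invOrderSum_pi fun p q hpq =>
      FourierDefect.coprime_card_pi_zmod_pow (hcoprime p q hpq) _ _,
    ← Finset.prod_coe_sort S]
  exact congrArg _ <| Finset.prod_congr rfl fun p _ =>
    FourierDefect.invOrderSum_pi_zmod_prime_pow (hS p p.2) (ha_zero p p.2) (hmono p)
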